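/- Let $S=k[x_1,\dots,x_n]$ be a standard graded polynomial ring over an algebraically closed field $k$. For a homogeneous ideal $I$ of $S$ let $e(S/I)$ denote the multiplicity of the graded ring $S/I$, and let $S_1$ be the space of linear forms. Let $x,y\in S_1$ and let $q$ be a quadratic form such that $\mathfrak q=(x,y,q)$ is a prime ideal of height $3$ with $e(S/\mathfrak q)=2$. Let $J$ be a homogeneous $\mathfrak q$-primary ideal with $e(S/J)=4$ that contains an ideal of height $3$ generated by quadratic forms. Then, after replacing $x,y$ by linear forms $x',y'$ with $(x',y')=(x,y)$ and $q$ by a quadratic form $q'$ with $q'-q\in(x,y)$ (so that still $\mathfrak q=(x',y',q')$), and writing again $x,y,q$ for $x',y',q'$, the ideal $J$ has one of the following forms: 1. $J=(x,y^2,q)$; 2. $J=(x^2,xy,y^2,q)+L'$, where $L'$ is an ideal generated by forms of degree at least $3$; 3. $J=(x^2,xy,y^2,ax+by,q)+L'$, where $a,b\in S_1$, $\operatorname{ht}(x,y,a,b,q)=5$, and $L'$ is an ideal generated by forms of degree at least $3$; 4. $J=(x^2,xy,y^2,ax+by,cx+dy,ad-bc+ex+fy)$, where $a,b,c,d,e,f\in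 S_1$, $q=ad-bc+ex+fy$, $\operatorname{ht}(x,y,a,b)=\operatorname{ht}(x,y,c,d)=4$ and $\operatorname{ht}(x,y,ad-bc)=3$. -/

import Mathlib

attribute [local instance] MvPolynomial.gradedAlgebra

/-- The Hilbert function of `S / J` for the standard grading of `S = k[x_1, ..., x_n]`: the
`k`-dimension of the degree `d` piece of `S / J`, that is, of the image of `S_d` in `S / J`. -/
noncomputable def quotientHilbertFunction {k : Type*} [Field k] {n : ℕ}
    (J : Ideal (MvPolynomial (Fin n) k)) (d : ℕ) : ℕ :=
  Module.finrank k
    ((MvPolynomial.homogeneousSubmodule (Fin n) k d).map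
      (Ideal.Quotient.mkₐ k J).toLinearMap)

/-- `P` is the Hilbert-Samuel polynomial of the graded ring `S / J`: for all large `d`, `P(d)` is
the `k`-dimension of `⨁_{i ≤ d} (S / J)_i`, which is the length of `S / (J + 𝔪 ^ (d + 1))`, where
`𝔪` is the ideal generated by the variables. -/
def IsHilbertSamuelPolynomial {k : Type*} [Field k] {n : ℕ}
    (J : Ideal (MvPolynomial (Fin n) k)) (P : Polynomial ℚ) : Prop :=
  ∀ᶠ d : ℕ in Filter.atTop,
    P.eval (d : ℚ) = ∑ i ∈ Finset.range (d + 1), (quotientHilbertFunction J i : ℚ)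

theorem IsHilbertSamuelPolynomial.unique {k : Type*} [Field k] {n : ℕ}
    {J : Ideal (MvPolynomial (Fin n) k)} {P Q : Polynomial ℚ}
    (hP : IsHilbertSamuelPolynomial J P) (hQ : IsHilbertSamuelPolynomial J Q) : P = Q := by
  obtain ⟨N, hN⟩ := Filter.eventually_atTop.1 (hP.and hQ)
  refine Polynomial.eq_of_infinite_eval_eq P Q
    (Set.Infinite.mono (s := (fun d : ℕ => (d : ℚ)) '' Set.Ici N) ?_ ?_)
  · rintro _ ⟨d, hd, rfl⟩
    exact (hN d hd).1.trans (hN d hd).2.symm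
  · exact (Set.Ici_infinite N).image (Nat.cast_injective.injOn)

open Classical in
/-- The Hilbert-Samuel polynomial of `S / J` (it exists for every homogeneous `J`). -/
noncomputable def hilbertSamuelPolynomial {k : Type*} [Field k] {n : ℕ}
    (J : Ideal (MvPolynomial (Fin n) k)) : Polynomial ℚ :=
  if h : ∃ P : Polynomial ℚ, IsHilbertSamuelPolynomial J P then h.choose else 0

theorem hilbertSamuelPolynomial_eq {k : Type*} [Field k] {n : ℕ}
    {J : Ideal (MvPolynomial (Fin n) k)} {P : Polynomial ℚ}
    (hP : IsHilbertSamuelPolynomial J P) : hilbertSamuelPolynomial J = P := by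
  have h : ∃ P : Polynomial ℚ, IsHilbertSamuelPolynomial J P := ⟨P, hP⟩
  rw [hilbertSamuelPolynomial, dif_pos h]
  exact h.choose_spec.unique hP

/-- The multiplicity `e(S / J)` of the graded ring `S / J`: if its Hilbert-Samuel polynomial has
degree `D` (which is then the Krull dimension of `S / J`) and leading coefficient `c`, then
`e(S / J) = D! c`. -/
noncomputable def quotientMultiplicity {k : Type*} [Field k] {n : ℕ}
    (J : Ideal (MvPolynomial (Fin n) k)) : ℚ :=
  ((hilbertSamuelPolynomial J).natDegree.factorial : ℚ) * (hilbertSamuelPolynomial J).leadingCoeff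

/-- `L` is generated by homogeneous polynomials of degree at least `m`. -/
def GeneratedInDegreesGE {k : Type*} [Field k] {n : ℕ}
    (L : Ideal (MvPolynomial (Fin n) k)) (m : ℕ) : Prop :=
  ∃ T : Set (MvPolynomial (Fin n) k),
    (∀ f ∈ T, ∃ d : ℕ, m ≤ d ∧ f.IsHomogeneous d) ∧ L = Ideal.span T

/-- `L` is generated by quadrics, that is, by homogeneous polynomials of degree `2`. -/
def GeneratedByQuadrics {k : Type*} [Field k] {n : ℕ}
    (L : Ideal (MvPolynomial (Fin n) k)) : Prop :=
  ∃ T : Set (MvPolynomial (Fin n) k), (∀ f ∈ T, f.IsHomogeneous 2) ∧ L = Ideal.span T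

/-! ### Graded pieces of a product -/

namespace MvPolynomial

section Graded

variable {σ R : Type*} [CommSemiring R]

/-! Write Q = (x, y, q). Since e(S/J) = 4 is twice e(S/Q), the localization of S/J at Q should have
length 2, which forces Q² ⊆ J. The proof uses only an inequality: if a form of Q² lay outside J,
there would be three layers in S/J, each at least as large as a shift of S/Q, whence e(S/J) ≥ 3 · 2
> 4. The layers are counted by Hilbert functions, with a Nakayama argument separating them
(`mem_of_mem_radical_sq_of_quotientMultiplicity_lt`).

The quadrics in J generate an ideal too high to fit in (x, y), so one of them, rescaled, is
congruent to q modulo (x, y) and can replace q. Now J contains x², xy, y² and q, and what remains is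
to find the relations ax + by in J.

If J contains a nonzero linear form αx + βy, it is a complete intersection (`eq_of_mem`). Otherwise
two relations ax + by, cx + dy in J satisfy ad - bc ∈ Q: by Cramer's rule this determinant carries x
and y into J, and J is primary (`det_mem`). For linear coefficients the determinant is thus a scalar
multiple of q modulo (x, y). If the scalar can be made nonzero, the two relations and q determine J
(`eq_of_det`). If it always vanishes, every relation with linear coefficients is, modulo (x, y)², a
multiple of a single one, because a, b is a regular sequence modulo (x, y)
(`exists_sub_mul_mem_of_det_mem`). This leaves at most one further quadric. -/

lemma homogeneousComponent_mul_of_isHomogeneous {w : MvPolynomial σ R} {e : ℕ}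
    (hw : w.IsHomogeneous e) (g : MvPolynomial σ R) (m : ℕ) :
    homogeneousComponent m (g * w) =
      if e ≤ m then homogeneousComponent (m - e) g * w else 0 := by
  have h : ∀ (f : MvPolynomial σ R) (i : ℕ),
      homogeneousComponent i f = (DirectSum.decompose (homogeneousSubmodule σ R) f i : _) :=
    fun f i => (decomposition.decompose'_apply f i).symm
  split_ifs with hem
  · rw [h, h]
    exact DirectSum.coe_decompose_mul_of_right_mem_of_le (homogeneousSubmodule σ R) hw hem
  · rw [h]
    exact DirectSum.coe_decompose_mul_of_right_mem_of_not_le (homogeneousSubmodule σ R) hw hem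

end Graded

end MvPolynomial

/-! ### Hilbert functions under adding a form and taking colons -/

section HilbertFunction

open MvPolynomial

variable {k : Type*} [Field k] {n : ℕ}

instance finiteDimensional_homogeneousSubmodule (d : ℕ) :
    FiniteDimensional k (homogeneousSubmodule (Fin n) k d) :=
  Module.Finite.iff_fg.2 (homogeneousSubmodule_fg (Fin n) k d)

lemma quotientHilbertFunction_add_finrank (J : Ideal (MvPolynomial (Fin n) k)) (d : ℕ) :
    quotientHilbertFunction J d +
      Module.finrank k ↥(homogeneousSubmodule (Fin n) k d ⊓ J.restrictScalars k) =
    Module.finrank k (homogeneousSubmodule (Fin n) k d) := by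
  set S := homogeneousSubmodule (Fin n) k d with hS
  let f : S →ₗ[k] (MvPolynomial (Fin n) k ⧸ J) := (Ideal.Quotient.mkₐ k J).toLinearMap.domRestrict S
  have h1 : f.range = S.map (Ideal.Quotient.mkₐ k J).toLinearMap :=
    LinearMap.range_domRestrict _ _
  have h2 : f.ker.map S.subtype = S ⊓ J.restrictScalars k := by
    ext g
    simp only [Submodule.mem_map, LinearMap.mem_ker, Submodule.mem_inf,
      Submodule.restrictScalars_mem]
    constructor
    · rintro ⟨⟨a, ha⟩, h, rfl⟩
      exact ⟨ha, Ideal.Quotient.eq_zero_iff_mem.1 h⟩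
    · rintro ⟨ha, h⟩
      exact ⟨⟨g, ha⟩, Ideal.Quotient.eq_zero_iff_mem.2 h, rfl⟩
  have h3 : Module.finrank k f.ker = Module.finrank k ↥(S ⊓ J.restrictScalars k) := by
    rw [← h2]
    exact (LinearEquiv.finrank_eq (Submodule.equivMapOfInjective _ S.injective_subtype f.ker))
  have h4 := f.finrank_range_add_finrank_ker
  rw [h1, h3] at h4
  exact h4

lemma quotientHilbertFunction_anti {J J' : Ideal (MvPolynomial (Fin n) k)} (h : J ≤ J') (d : ℕ) :
    quotientHilbertFunction J' d ≤ quotientHilbertFunction J d := by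
  have h1 := quotientHilbertFunction_add_finrank J d
  have h2 := quotientHilbertFunction_add_finrank J' d
  have h3 : Module.finrank k ↥(homogeneousSubmodule (Fin n) k d ⊓ J.restrictScalars k) ≤
      Module.finrank k ↥(homogeneousSubmodule (Fin n) k d ⊓ J'.restrictScalars k) :=
    Submodule.finrank_mono (inf_le_inf_left _ h)
  omega

lemma quotientHilbertFunction_top (d : ℕ) :
    quotientHilbertFunction (⊤ : Ideal (MvPolynomial (Fin n) k)) d = 0 := by
  have h := quotientHilbertFunction_add_finrank (⊤ : Ideal (MvPolynomial (Fin n) k)) d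
  rw [Submodule.restrictScalars_top, inf_top_eq] at h
  omega

lemma exists_of_mem_sup_span_singleton {J : Ideal (MvPolynomial (Fin n) k)}
    (hJ : J.IsHomogeneous (homogeneousSubmodule (Fin n) k)) {w : MvPolynomial (Fin n) k} {e : ℕ}
    (hw : w.IsHomogeneous e) {m : ℕ} {f : MvPolynomial (Fin n) k} (hf : f.IsHomogeneous m)
    (hfJ : f ∈ J ⊔ Ideal.span {w}) :
    ∃ j ∈ J, j.IsHomogeneous m ∧ ∃ g : MvPolynomial (Fin n) k,
      f = j + if e ≤ m then homogeneousComponent (m - e) g * w else 0 := by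
  obtain ⟨j, hj, v, hv, rfl⟩ := Submodule.mem_sup.1 hfJ
  obtain ⟨g, rfl⟩ := Ideal.mem_span_singleton'.1 hv
  refine ⟨homogeneousComponent m j, homogeneousComponent_mem_of_mem hJ hj m,
    homogeneousComponent_isHomogeneous m j, g, ?_⟩
  rw [← homogeneousComponent_mul_of_isHomogeneous hw, ← map_add, homogeneousComponent_eq_self hf]

lemma quotientHilbertFunction_sup_span_singleton_of_lt {J : Ideal (MvPolynomial (Fin n) k)}
    (hJ : J.IsHomogeneous (homogeneousSubmodule (Fin n) k)) {w : MvPolynomial (Fin n) k} {e : ℕ}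
    (hw : w.IsHomogeneous e) {m : ℕ} (hm : m < e) :
    quotientHilbertFunction (J ⊔ Ideal.span {w}) m = quotientHilbertFunction J m := by
  have h1 := quotientHilbertFunction_add_finrank J m
  have h2 := quotientHilbertFunction_add_finrank (J ⊔ Ideal.span {w}) m
  have h3 : homogeneousSubmodule (Fin n) k m ⊓ (J ⊔ Ideal.span {w}).restrictScalars k =
      homogeneousSubmodule (Fin n) k m ⊓ J.restrictScalars k := by
    refine le_antisymm ?_ (inf_le_inf_left _ (le_sup_left : J ≤ J ⊔ Ideal.span {w}))
    rintro f ⟨hf, hfJ⟩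
    obtain ⟨j, hj, -, g, hg⟩ := exists_of_mem_sup_span_singleton hJ hw hf hfJ
    rw [if_neg (not_le.2 hm), add_zero] at hg
    exact ⟨hf, by rw [hg]; exact hj⟩
  rw [h3] at h2
  omega

/-- This is the exact sequence 0 → S/(J : w)(-e) → S/J → S/(J + (w)) → 0, counted inside S: in
degree d + e the ideal J + (w) is the sum of J and w · S_d, which meet in w · (J : w)_d. -/
lemma quotientHilbertFunction_add_eq {J : Ideal (MvPolynomial (Fin n) k)}
    (hJ : J.IsHomogeneous (homogeneousSubmodule (Fin n) k)) {w : MvPolynomial (Fin n) k} {e : ℕ}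
    (hw : w.IsHomogeneous e) (hw0 : w ≠ 0) (d : ℕ) :
    quotientHilbertFunction J (d + e) =
      quotientHilbertFunction (J ⊔ Ideal.span {w}) (d + e) +
        quotientHilbertFunction (J.colon {w}) d := by
  have h1 := quotientHilbertFunction_add_finrank J (d + e)
  have h2 := quotientHilbertFunction_add_finrank (J ⊔ Ideal.span {w}) (d + e)
  have h3 := quotientHilbertFunction_add_finrank (J.colon {w}) d
  let μ : MvPolynomial (Fin n) k →ₗ[k] MvPolynomial (Fin n) k := LinearMap.mulRight k w
  have hμ : Function.Injective μ := mul_left_injective₀ hw0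
  have hfr : ∀ p : Submodule k (MvPolynomial (Fin n) k),
      Module.finrank k (p.map μ) = Module.finrank k p := fun p =>
    (LinearEquiv.finrank_eq (Submodule.equivMapOfInjective _ hμ p)).symm
  set S := homogeneousSubmodule (Fin n) k d with hS
  set T := homogeneousSubmodule (Fin n) k (d + e) with hT
  have hST : S.map μ ≤ T := by
    rintro _ ⟨g, hg, rfl⟩
    exact IsHomogeneous.mul hg hw
  have h4 : T ⊓ (J ⊔ Ideal.span {w}).restrictScalars k =
      (T ⊓ J.restrictScalars k) ⊔ S.map μ := by
    refine le_antisymm ?_ (sup_le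
      (inf_le_inf_left _ (le_sup_left : J ≤ J ⊔ Ideal.span {w})) (le_inf hST ?_))
    · rintro f ⟨hf, hfJ⟩
      obtain ⟨j, hj, hjm, g, hg⟩ := exists_of_mem_sup_span_singleton hJ hw hf hfJ
      rw [if_pos (Nat.le_add_left e d), Nat.add_sub_cancel] at hg
      rw [hg]
      exact Submodule.add_mem_sup ⟨hjm, hj⟩
        ⟨homogeneousComponent d g, homogeneousComponent_isHomogeneous d g, rfl⟩
    · rintro _ ⟨g, -, rfl⟩
      exact Ideal.mem_sup_right (Ideal.mul_mem_left _ g (Ideal.mem_span_singleton_self w))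
  have h5 : (T ⊓ J.restrictScalars k) ⊓ S.map μ =
      (S ⊓ (J.colon {w}).restrictScalars k).map μ := by
    ext f
    constructor
    · rintro ⟨⟨-, hf⟩, g, hg, rfl⟩
      exact ⟨g, ⟨hg, Submodule.mem_colon_singleton.2 hf⟩, rfl⟩
    · rintro ⟨g, ⟨hg, hgJ⟩, rfl⟩
      exact ⟨⟨hST ⟨g, hg, rfl⟩, Submodule.mem_colon_singleton.1 hgJ⟩, g, hg, rfl⟩
  have : FiniteDimensional k ↥(T ⊓ J.restrictScalars k) :=
    Submodule.finiteDimensional_of_le inf_le_left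
  have : FiniteDimensional k ↥(S.map μ) := Submodule.finiteDimensional_of_le hST
  have h6 := Submodule.finrank_sup_add_finrank_inf_eq (T ⊓ J.restrictScalars k) (S.map μ)
  rw [← h4, h5, hfr, hfr] at h6
  omega

/-- The `k`-dimension of `⨁_{i ≤ d} (S / J)_i`. -/
noncomputable def quotientHilbertSum (J : Ideal (MvPolynomial (Fin n) k)) (d : ℕ) : ℕ :=
  ∑ i ∈ Finset.range (d + 1), quotientHilbertFunction J i

lemma quotientHilbertSum_anti {J J' : Ideal (MvPolynomial (Fin n) k)} (h : J ≤ J') (d : ℕ) :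
    quotientHilbertSum J' d ≤ quotientHilbertSum J d :=
  Finset.sum_le_sum fun i _ => quotientHilbertFunction_anti h i

lemma quotientHilbertSum_mono (J : Ideal (MvPolynomial (Fin n) k)) :
    Monotone (quotientHilbertSum J) := fun _ _ h =>
  Finset.sum_le_sum_of_subset (Finset.range_mono (by omega))

lemma quotientHilbertSum_add_eq {J : Ideal (MvPolynomial (Fin n) k)}
    (hJ : J.IsHomogeneous (homogeneousSubmodule (Fin n) k)) {w : MvPolynomial (Fin n) k} {e : ℕ}
    (hw : w.IsHomogeneous e) (hw0 : w ≠ 0) (d : ℕ) :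
    quotientHilbertSum J (d + e) =
      quotientHilbertSum (J ⊔ Ideal.span {w}) (d + e) + quotientHilbertSum (J.colon {w}) d := by
  have h : ∀ K : Ideal (MvPolynomial (Fin n) k), quotientHilbertSum K (d + e) =
      ∑ i ∈ Finset.range e, quotientHilbertFunction K i +
        ∑ i ∈ Finset.range (d + 1), quotientHilbertFunction K (i + e) := by
    intro K
    rw [quotientHilbertSum, show d + e + 1 = e + (d + 1) by ring, Finset.sum_range_add]
    simp only [add_comm e]
  rw [h J, h (J ⊔ Ideal.span {w}), quotientHilbertSum,
    Finset.sum_congr rfl fun i hi => (quotientHilbertFunction_sup_span_singleton_of_lt hJ hw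
      (Finset.mem_range.1 hi)).symm,
    Finset.sum_congr rfl fun i _ => quotientHilbertFunction_add_eq hJ hw hw0 i,
    Finset.sum_add_distrib, add_assoc]

/-- Dropping the degree shift costs equality but gives a bound valid for every d, including d < e.
-/
lemma quotientHilbertSum_le_add {J : Ideal (MvPolynomial (Fin n) k)}
    (hJ : J.IsHomogeneous (homogeneousSubmodule (Fin n) k)) {w : MvPolynomial (Fin n) k} {e : ℕ}
    (hw : w.IsHomogeneous e) (hw0 : w ≠ 0) (d : ℕ) :
    quotientHilbertSum J d ≤
      quotientHilbertSum (J ⊔ Ideal.span {w}) d + quotientHilbertSum (J.colon {w}) d := by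
  rcases lt_or_ge d e with h | h
  · refine le_add_right (le_of_eq (Finset.sum_congr rfl fun i hi => ?_))
    have hi' := Finset.mem_range.1 hi
    exact (quotientHilbertFunction_sup_span_singleton_of_lt hJ hw (by omega)).symm
  · obtain ⟨c, rfl⟩ := Nat.exists_eq_add_of_le' h
    rw [quotientHilbertSum_add_eq hJ hw hw0 c]
    exact Nat.add_le_add_left (quotientHilbertSum_mono _ (Nat.le_add_right c e)) _

lemma isHomogeneous_sup_span_singleton {J : Ideal (MvPolynomial (Fin n) k)}
    (hJ : J.IsHomogeneous (homogeneousSubmodule (Fin n) k)) {w : MvPolynomial (Fin n) k} {e : ℕ}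
    (hw : w.IsHomogeneous e) :
    (J ⊔ Ideal.span {w}).IsHomogeneous (homogeneousSubmodule (Fin n) k) := by
  refine hJ.sup (Ideal.homogeneous_span _ _ ?_)
  rintro _ rfl
  exact ⟨e, hw⟩

/-- If `T` generates an ideal some power of which carries `w` into `J`, then some homogeneous
multiple of `w` outside `J` is carried into `J` by all of `T`. -/
lemma exists_dvd_notMem_of_pow_mul_mem {J : Ideal (MvPolynomial (Fin n) k)}
    {T : Set (MvPolynomial (Fin n) k)} (hT : ∀ t ∈ T, ∃ d : ℕ, t.IsHomogeneous d) (N : ℕ)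
    (w : MvPolynomial (Fin n) k) (hw : ∃ d : ℕ, w.IsHomogeneous d) (hwJ : w ∉ J)
    (hN : ∀ f ∈ Ideal.span T ^ N, f * w ∈ J) :
    ∃ v : MvPolynomial (Fin n) k, (∃ d : ℕ, v.IsHomogeneous d) ∧ w ∣ v ∧ v ∉ J ∧
      Ideal.span T ≤ J.colon {v} := by
  induction N generalizing w with
  | zero => exact absurd (by simpa using hN 1 (by simp)) hwJ
  | succ N ih =>
    by_cases h : ∀ t ∈ T, t * w ∈ J
    · exact ⟨w, hw, dvd_rfl, hwJ,
        Ideal.span_le.2 fun t ht => Submodule.mem_colon_singleton.2 (h t ht)⟩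
    · push Not at h
      obtain ⟨t, ht, htw⟩ := h
      obtain ⟨d, hd⟩ := hw
      obtain ⟨c, hc⟩ := hT t ht
      obtain ⟨v, hv, hdvd, hvJ, hle⟩ := ih (t * w) ⟨c + d, hc.mul hd⟩ htw fun f hf => by
        rw [← mul_assoc]
        exact hN _ (by rw [pow_succ]; exact Ideal.mul_mem_mul hf (Ideal.subset_span ht))
      exact ⟨v, hv, (dvd_mul_left w t).trans hdvd, hvJ, hle⟩

/-- S/J has a finite filtration by cyclic modules killed by `T`, and C counts its steps. The bound
keeps S/J from growing faster than S/(T). -/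
lemma exists_quotientHilbertSum_le_mul {T : Set (MvPolynomial (Fin n) k)}
    (hT : ∀ t ∈ T, ∃ d : ℕ, t.IsHomogeneous d) (N : ℕ) (J : Ideal (MvPolynomial (Fin n) k))
    (hJ : J.IsHomogeneous (homogeneousSubmodule (Fin n) k)) (hN : Ideal.span T ^ N ≤ J) :
    ∃ C : ℕ, ∀ d, quotientHilbertSum J d ≤ C * quotientHilbertSum (Ideal.span T) d := by
  induction J using IsNoetherian.induction with
  | hgt J ih =>
    by_cases h1 : (1 : MvPolynomial (Fin n) k) ∈ J
    · refine ⟨0, fun d => ?_⟩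
      rw [(Ideal.eq_top_iff_one J).2 h1, quotientHilbertSum]
      simp [quotientHilbertFunction_top]
    · obtain ⟨v, ⟨e, hv⟩, -, hvJ, hle⟩ := exists_dvd_notMem_of_pow_mul_mem hT N 1
        ⟨0, isHomogeneous_one _ _⟩ h1 fun f hf => by rw [mul_one]; exact hN hf
      obtain ⟨C, hC⟩ := ih (J ⊔ Ideal.span {v})
        (left_lt_sup.2 fun h => hvJ (h (Ideal.mem_span_singleton_self v)))
        (isHomogeneous_sup_span_singleton hJ hv) (hN.trans le_sup_left)
      refine ⟨C + 1, fun d => ?_⟩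
      have hv0 : v ≠ 0 := fun h => hvJ (h ▸ J.zero_mem)
      calc quotientHilbertSum J d ≤ _ := quotientHilbertSum_le_add hJ hv hv0 d
        _ ≤ C * quotientHilbertSum (Ideal.span T) d + quotientHilbertSum (Ideal.span T) d :=
          add_le_add (hC d) (quotientHilbertSum_anti hle d)
        _ = _ := by ring

end HilbertFunction

/-! ### Comparing leading coefficients of Hilbert-Samuel polynomials -/

section Multiplicity

open Filter Topology

lemma Polynomial.natDegree_le_of_eventually_le {P Q : Polynomial ℚ} (hP : P ≠ 0) (C : ℚ)
    (h0 : ∀ᶠ d : ℕ in atTop, 0 ≤ P.eval (d : ℚ))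
    (h : ∀ᶠ d : ℕ in atTop, P.eval (d : ℚ) ≤ C * Q.eval (d : ℚ)) :
    P.natDegree ≤ Q.natDegree := by
  by_contra! hlt
  have hdeg : Q.degree < P.degree := Polynomial.degree_lt_degree hlt
  have h1 := ((Polynomial.div_tendsto_atTop_zero_of_degree_lt Q P hdeg).const_mul C).comp
    (tendsto_natCast_atTop_atTop (R := ℚ))
  rw [mul_zero] at h1
  have h2 := tendsto_natCast_atTop_atTop (R := ℚ) (Polynomial.eventually_atTop_not_isRoot P hP)
  obtain ⟨d, h3, h4, h5, h6⟩ :=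
    ((h1.eventually_lt_const one_pos).and (h0.and (h.and h2))).exists
  have h7 : 0 < P.eval (d : ℚ) := lt_of_le_of_ne h4 (Ne.symm h6)
  have h8 : C * (Q.eval (d : ℚ) / P.eval (d : ℚ)) < 1 := h3
  rw [← mul_div_assoc, div_lt_one h7] at h8
  exact absurd h5 (not_le.2 h8)

variable {k : Type*} [Field k] {n : ℕ}

/-- The default polynomial 0 has multiplicity 0, so a nonzero multiplicity already guarantees a
genuine Hilbert-Samuel polynomial. -/
lemma exists_isHilbertSamuelPolynomial_of_quotientMultiplicity_ne_zero
    {J : Ideal (MvPolynomial (Fin n) k)} (h : quotientMultiplicity J ≠ 0) :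
    ∃ P : Polynomial ℚ, P ≠ 0 ∧
      (∀ᶠ d : ℕ in atTop, P.eval (d : ℚ) = (quotientHilbertSum J d : ℚ)) ∧
      quotientMultiplicity J = (P.natDegree.factorial : ℚ) * P.leadingCoeff := by
  by_cases hex : ∃ P : Polynomial ℚ, IsHilbertSamuelPolynomial J P
  · obtain ⟨P, hP⟩ := hex
    have hm : quotientMultiplicity J = (P.natDegree.factorial : ℚ) * P.leadingCoeff := by
      rw [quotientMultiplicity, hilbertSamuelPolynomial_eq hP]
    refine ⟨P, ?_, hP.mono fun d hd => by rw [hd, quotientHilbertSum]; push_cast; rfl, hm⟩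
    rintro rfl
    exact h (by simp [hm])
  · exact absurd (by simp [quotientMultiplicity, hilbertSamuelPolynomial, dif_neg hex]) h

/-- Multiplicities can be compared through Hilbert sums of the same growth. -/
lemma mul_quotientMultiplicity_le {J Q : Ideal (MvPolynomial (Fin n) k)}
    (hJ : quotientMultiplicity J ≠ 0) (hQ : 0 < quotientMultiplicity Q) (C E r : ℕ)
    (hr : 0 < r)
    (hle : ∀ d, quotientHilbertSum J d ≤ C * quotientHilbertSum Q d)
    (hge : ∀ d, r * quotientHilbertSum Q d ≤ quotientHilbertSum J (d + E)) :
    (r : ℚ) * quotientMultiplicity Q ≤ quotientMultiplicity J := by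
  obtain ⟨P, hP0, hP, hPm⟩ := exists_isHilbertSamuelPolynomial_of_quotientMultiplicity_ne_zero hJ
  obtain ⟨R, hR0, hR, hRm⟩ :=
    exists_isHilbertSamuelPolynomial_of_quotientMultiplicity_ne_zero hQ.ne'
  have hrq : (0 : ℚ) < r := Nat.cast_pos.2 hr
  have hPR : P.natDegree ≤ R.natDegree := by
    refine Polynomial.natDegree_le_of_eventually_le hP0 C ?_ ?_
    · filter_upwards [hP] with d h
      rw [h]; positivity
    · filter_upwards [hP, hR] with d h h'
      rw [h, h']
      exact_mod_cast hle d
  -- The shift by `E` changes neither degree nor leading coefficient, so the two bounds force equal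
  -- degrees and the limit of P'/R is the ratio of leading coefficients.
  set P' : Polynomial ℚ := P.comp (Polynomial.X + Polynomial.C (E : ℚ)) with hP'
  have hdeg' : P'.natDegree = P.natDegree := by
    rw [hP', Polynomial.natDegree_comp, Polynomial.natDegree_X_add_C, mul_one]
  have hlead : P'.leadingCoeff = P.leadingCoeff := by
    rw [hP', Polynomial.leadingCoeff_comp (by rw [Polynomial.natDegree_X_add_C]; exact one_ne_zero),
      Polynomial.leadingCoeff_X_add_C, one_pow, mul_one]
  have hP'0 : P' ≠ 0 := fun h => hP0 (Polynomial.leadingCoeff_eq_zero.1 (by rw [← hlead, h]; simp))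
  have hP'e : ∀ᶠ d : ℕ in atTop, P'.eval (d : ℚ) = (quotientHilbertSum J (d + E) : ℚ) := by
    filter_upwards [(tendsto_add_atTop_nat E).eventually hP] with d h
    rw [← h, hP']
    simp
  have hRP : R.natDegree ≤ P'.natDegree := by
    refine Polynomial.natDegree_le_of_eventually_le hR0 1 ?_ ?_
    · filter_upwards [hR] with d h
      rw [h]; positivity
    · filter_upwards [hP'e, hR] with d h h'
      rw [h, h', one_mul]
      exact_mod_cast (Nat.le_mul_of_pos_left _ hr).trans (hge d)
  have hnat : P.natDegree = R.natDegree := le_antisymm hPR (hdeg' ▸ hRP)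
  have hlim := (Polynomial.div_tendsto_atTop_leadingCoeff_div_of_degree_eq P' R
    (by rw [Polynomial.degree_eq_natDegree hP'0, Polynomial.degree_eq_natDegree hR0, hdeg',
      hnat])).comp (tendsto_natCast_atTop_atTop (R := ℚ))
  have hroot := tendsto_natCast_atTop_atTop (R := ℚ) (Polynomial.eventually_atTop_not_isRoot R hR0)
  have hRlc : 0 < R.leadingCoeff := by
    rw [hRm] at hQ
    exact pos_of_mul_pos_right hQ (by positivity)
  have hfin : (r : ℚ) ≤ P'.leadingCoeff / R.leadingCoeff := by
    refine ge_of_tendsto hlim ?_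
    filter_upwards [hP'e, hR, hroot] with d h h' h0
    have hpos : 0 < R.eval (d : ℚ) :=
      lt_of_le_of_ne (by rw [h']; positivity) (Ne.symm h0)
    rw [Function.comp_apply, le_div_iff₀ hpos, h, h']
    exact_mod_cast hge d
  rw [le_div_iff₀ hRlc, hlead] at hfin
  rw [hPm, hRm, hnat, mul_left_comm]
  exact mul_le_mul_of_nonneg_left hfin (by positivity)

end Multiplicity

/-! ### The square of the radical lies in J -/

section Primary

open MvPolynomial

variable {k : Type*} [Field k] {n : ℕ}

/-- A form of Nakayama's lemma for primary ideals. -/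
lemma Ideal.radical_le_of_mul_radical_le {R : Type*} [CommRing R] {J : Ideal R}
    (hJ : J.IsPrimary) {N : ℕ} (hN : J.radical ^ N ≤ J) {s : R} (hs : s ∉ J.radical)
    (h : ∀ f ∈ J.radical, s * f ∈ J ⊔ J.radical ^ 2) : J.radical ≤ J := by
  -- Powers of `s` replace localization at the radical: each factor of `s` gains one power of the
  -- radical, and the `N`-th power is absorbed by J.
  have key : ∀ m : ℕ, ∀ f ∈ J.radical, s ^ m * f ∈ J ⊔ J.radical ^ (m + 1) := by
    intro m
    induction m with
    | zero => exact fun f hf => by simpa using Ideal.mem_sup_right hf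
    | succ m ih =>
      intro f hf
      obtain ⟨j, hj, g, hg, hjg⟩ := Submodule.mem_sup.1 (ih f hf)
      rw [pow_succ' s m, mul_assoc, ← hjg, mul_add]
      refine add_mem (Ideal.mem_sup_left (J.mul_mem_left s hj)) ?_
      rw [pow_succ] at hg
      refine Submodule.mul_induction_on hg (fun a ha b hb => ?_) fun a b ha hb => ?_
      · obtain ⟨j', hj', g', hg', e⟩ := Submodule.mem_sup.1 (h b hb)
        rw [show s * (a * b) = a * (s * b) by ring, ← e, mul_add]
        refine add_mem (Ideal.mem_sup_left (J.mul_mem_left a hj')) (Ideal.mem_sup_right ?_)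
        rw [show m + 1 + 1 = m + 2 by ring, pow_add]
        exact Ideal.mul_mem_mul ha hg'
      · rw [mul_add]; exact add_mem ha hb
  intro f hf
  have h1 : s ^ N * f ∈ J := by
    have h2 := key N f hf
    rwa [sup_eq_left.2 ((Ideal.pow_le_pow_right N.le_succ).trans hN)] at h2
  have hprime := Ideal.isPrime_radical hJ
  exact ((Ideal.isPrimary_iff.1 hJ).2 (mul_comm (s ^ N) f ▸ h1)).resolve_right
    fun h2 => hs (hprime.mem_of_pow_mem N h2)

/-- If `S / J` has multiplicity less than three times that of `S / √J`, where `J` is primary and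
not prime, then `J` contains every form in the square of `√J`. -/
theorem mem_of_mem_radical_sq_of_quotientMultiplicity_lt {J : Ideal (MvPolynomial (Fin n) k)}
    {T : Set (MvPolynomial (Fin n) k)} (hT : ∀ t ∈ T, ∃ d : ℕ, t.IsHomogeneous d)
    (hJhom : J.IsHomogeneous (homogeneousSubmodule (Fin n) k)) (hJ : J.IsPrimary)
    (hrad : J.radical = Ideal.span T) (hne : ¬ Ideal.span T ≤ J)
    (hJm : quotientMultiplicity J ≠ 0) (hTm : 0 < quotientMultiplicity (Ideal.span T))
    (hlt : quotientMultiplicity J < 3 * quotientMultiplicity (Ideal.span T))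
    {w : MvPolynomial (Fin n) k} (hw : ∃ d : ℕ, w.IsHomogeneous d)
    (hw2 : w ∈ Ideal.span T ^ 2) : w ∈ J := by
  by_contra hwJ
  obtain ⟨N, hN⟩ := Ideal.exists_radical_pow_le_of_fg J (IsNoetherian.noetherian _)
  have hN' := hN
  rw [hrad] at hN'
  obtain ⟨v, ⟨e, hv⟩, hdvd, hvJ, hle⟩ := exists_dvd_notMem_of_pow_mul_mem hT N w hw hwJ
    fun f hf => J.mul_mem_right w (hN' hf)
  have hprime : (Ideal.span T).IsPrime := hrad ▸ Ideal.isPrime_radical hJ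
  have hv2 : v ∈ Ideal.span T ^ 2 := Ideal.mem_of_dvd _ hdvd hw2
  have hcolon : J.colon {v} ≤ Ideal.span T := fun s hs => by
    rw [← hrad]
    refine ((Ideal.isPrimary_iff.1 hJ).2 (x := v) (y := s) ?_).resolve_left hvJ
    rw [mul_comm]
    exact Submodule.mem_colon_singleton.1 hs
  set J' := J ⊔ Ideal.span {v} with hJ'
  have hJ'hom : J'.IsHomogeneous (homogeneousSubmodule (Fin n) k) := isHomogeneous_sup_span_singleton hJhom hv
  have hJ'le : J' ≤ J ⊔ Ideal.span T ^ 2 :=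
    sup_le_sup_left ((Ideal.span_singleton_le_iff_mem _).2 hv2) _
  -- Otherwise each generator is carried into `J'` by an element outside the prime. The product of
  -- these over finitely many generators carries the whole prime into J' ⊆ J + (T)², against
  -- Nakayama.
  have hz : ∃ z ∈ T, J'.colon {z} ≤ Ideal.span T := by
    by_contra! h
    have hs : ∃ s, s ∉ Ideal.span T ∧ ∀ f ∈ Ideal.span T, s * f ∈ J' := by
      obtain ⟨T', hT', hT's⟩ := Submodule.fg_span_iff_fg_span_finset_subset T |>.1
        (IsNoetherian.noetherian (Ideal.span T))
      have h' : ∀ t : T', ∃ s, s ∉ Ideal.span T ∧ s * t ∈ J' := by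
        rintro ⟨t, ht⟩
        obtain ⟨s, hs, hs'⟩ := Set.not_subset.1 (h t (hT' ht))
        exact ⟨s, hs', Submodule.mem_colon_singleton.1 hs⟩
      choose s hs hs' using h'
      refine ⟨∏ t, s t, ?_, fun f hf => ?_⟩
      · rw [hprime.prod_mem_iff]
        rintro ⟨t, -, ht⟩
        exact hs t ht
      · have : Ideal.span T ≤ J'.colon {∏ t, s t} := by
          rw [Ideal.span, hT's]
          refine Ideal.span_le.2 fun t ht => Submodule.mem_colon_singleton.2 ?_
          obtain ⟨c, hc⟩ := Finset.dvd_prod_of_mem s (Finset.mem_univ (⟨t, ht⟩ : T'))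
          rw [smul_eq_mul, hc, show t * (s ⟨t, ht⟩ * c) = c * (s ⟨t, ht⟩ * t) by ring]
          exact J'.mul_mem_left c (hs' ⟨t, ht⟩)
        rw [mul_comm]
        exact Submodule.mem_colon_singleton.1 (this hf)
    obtain ⟨s, hs, hs'⟩ := hs
    refine hne (hrad ▸ Ideal.radical_le_of_mul_radical_le hJ hN (s := s) (hrad ▸ hs) ?_)
    rw [hrad]
    exact fun f hf => hJ'le (hs' f hf)
  obtain ⟨z, hzT, hzc⟩ := hz
  obtain ⟨c, hc⟩ := hT z hzT
  have hv0 : v ≠ 0 := fun h => hvJ (h ▸ J.zero_mem)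
  have hz0 : z ≠ 0 := by
    rintro rfl
    exact hprime.ne_top ((Ideal.eq_top_iff_one _).2
      (hzc (Submodule.mem_colon_singleton.2 (by simp))))
  have hJT : J ≤ Ideal.span T := hrad ▸ Ideal.le_radical
  have hJ'z : J' ⊔ Ideal.span {z} ≤ Ideal.span T :=
    sup_le (hJ'le.trans (sup_le hJT (Ideal.pow_le_self two_ne_zero)))
      ((Ideal.span_singleton_le_iff_mem _).2 (Ideal.subset_span hzT))
  obtain ⟨C, hC⟩ := exists_quotientHilbertSum_le_mul hT N J hJhom hN'
  -- The factor 3 comes from the layers S/(J : v), S/(J' : z) and S/(J' + (z)), whose three ideals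
  -- all lie in (T); c + e is the total degree of `z` and `v`.
  refine absurd (mul_quotientMultiplicity_le hJm hTm C (c + e) 3 (by norm_num) hC fun d => ?_)
    (not_le.2 (by exact_mod_cast hlt))
  have h1 := quotientHilbertSum_add_eq hJhom hv hv0 (d + c)
  have h2 := quotientHilbertSum_add_eq hJ'hom hc hz0 (d + e)
  have h3 := quotientHilbertSum_anti hcolon (d + c)
  have h4 := quotientHilbertSum_anti hzc (d + e)
  have h5 := quotientHilbertSum_anti hJ'z (d + e + c)
  have h6 := quotientHilbertSum_mono (Ideal.span T) (Nat.le_add_right d c)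
  have h7 := quotientHilbertSum_mono (Ideal.span T) (Nat.le_add_right d e)
  have h8 := quotientHilbertSum_mono (Ideal.span T) (show d ≤ d + e + c by omega)
  rw [show d + c + e = d + (c + e) by ring, ← hJ'] at h1
  rw [show d + e + c = d + (c + e) by ring] at h2 h5 h8
  omega

end Primary

/-! ### Ideals of linear forms and coefficients of bounded degree -/

section LinearForms

open MvPolynomial

variable {k : Type*} [Field k] {n : ℕ}

/-- Substitute for each variable its image under a linear projection killing the span of `T`. The
substitution is the identity modulo (T), so its kernel is no larger than (T); as its target is a
domain, (T) is prime. -/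
lemma exists_algHom_ker_eq_span_of_isHomogeneous_one {T : Set (MvPolynomial (Fin n) k)}
    (hT : ∀ t ∈ T, t.IsHomogeneous 1) :
    ∃ φ : MvPolynomial (Fin n) k →ₐ[k] MvPolynomial (Fin n) k,
      RingHom.ker φ = Ideal.span T ∧
      ∀ l : MvPolynomial (Fin n) k, l.IsHomogeneous 1 → l - φ l ∈ Submodule.span k T := by
  obtain ⟨π, hπ0, hπ⟩ : ∃ π : MvPolynomial (Fin n) k →ₗ[k] MvPolynomial (Fin n) k,
      (∀ v ∈ Submodule.span k T, π v = 0) ∧ ∀ l, l - π l ∈ Submodule.span k T := by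
    obtain ⟨W, hW⟩ := Submodule.exists_isCompl (Submodule.span k T)
    obtain ⟨p, hp⟩ := (Submodule.span k T).subtype.exists_leftInverse_of_injective
      (Submodule.ker_subtype _)
    refine ⟨LinearMap.id - (Submodule.span k T).subtype ∘ₗ p, fun v hv => ?_, fun l => ?_⟩
    · have := LinearMap.congr_fun hp ⟨v, hv⟩
      simp only [LinearMap.comp_apply, Submodule.subtype_apply, LinearMap.id_apply] at this
      simp [this]
    · simp
  let φ : MvPolynomial (Fin n) k →ₐ[k] MvPolynomial (Fin n) k := aeval fun i => π (X i)
  have hφ1 : ∀ l : MvPolynomial (Fin n) k, l.IsHomogeneous 1 → φ l = π l := by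
    intro l hl
    have hl' : l ∈ homogeneousSubmodule (Fin n) k 1 := hl
    rw [homogeneousSubmodule_one_eq_span_X] at hl'
    refine LinearMap.eqOn_span (f := φ.toLinearMap) (g := π) ?_ hl'
    rintro _ ⟨i, rfl⟩
    exact aeval_X _ i
  have hspan : ∀ v ∈ Submodule.span k T, v ∈ Ideal.span T := fun v hv =>
    Submodule.span_le_restrictScalars k (MvPolynomial (Fin n) k) T hv
  refine ⟨φ, le_antisymm (fun f hf => ?_) (Ideal.span_le.2 fun t ht => ?_), fun l hl => ?_⟩
  · have h : (Ideal.Quotient.mkₐ k (Ideal.span T)).comp φ = Ideal.Quotient.mkₐ k (Ideal.span T) :=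
      MvPolynomial.algHom_ext fun i => by
        rw [AlgHom.comp_apply, aeval_X]
        exact (Ideal.Quotient.eq.2 (hspan _ (hπ (X i)))).symm
    have h2 := AlgHom.congr_fun h f
    rw [AlgHom.comp_apply, RingHom.mem_ker.1 hf, map_zero] at h2
    exact Ideal.Quotient.eq_zero_iff_mem.1 h2.symm
  · exact RingHom.mem_ker.2 ((hφ1 t (hT t ht)).trans (hπ0 t (Submodule.subset_span ht)))
  · rw [hφ1 l hl]
    exact hπ l

lemma isPrime_span_of_isHomogeneous_one {T : Set (MvPolynomial (Fin n) k)}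
    (hT : ∀ t ∈ T, t.IsHomogeneous 1) : (Ideal.span T).IsPrime := by
  obtain ⟨φ, hφ, -⟩ := exists_algHom_ker_eq_span_of_isHomogeneous_one hT
  exact hφ ▸ RingHom.ker_isPrime φ

lemma mem_span_of_isHomogeneous_one {T : Set (MvPolynomial (Fin n) k)}
    (hT : ∀ t ∈ T, t.IsHomogeneous 1) {l : MvPolynomial (Fin n) k} (hl : l.IsHomogeneous 1)
    (h : l ∈ Ideal.span T) : l ∈ Submodule.span k T := by
  obtain ⟨φ, hφ, hφl⟩ := exists_algHom_ker_eq_span_of_isHomogeneous_one hT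
  have h' := hφl l hl
  rw [← hφ] at h
  rwa [RingHom.mem_ker.1 h, sub_zero] at h'

lemma isHomogeneous_span {s : Set (MvPolynomial (Fin n) k)}
    (hs : ∀ t ∈ s, ∃ d : ℕ, t.IsHomogeneous d) :
    (Ideal.span s).IsHomogeneous (homogeneousSubmodule (Fin n) k) :=
  Ideal.homogeneous_span _ _ hs

lemma exists_sub_mul_mem_span {s : Set (MvPolynomial (Fin n) k)}
    (hs : ∀ t ∈ s, ∃ d : ℕ, t.IsHomogeneous d) {w f : MvPolynomial (Fin n) k} {d e : ℕ}
    (hw : w.IsHomogeneous e) (hf : f.IsHomogeneous (d + e)) (h : f ∈ Ideal.span (insert w s)) :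
    ∃ g : MvPolynomial (Fin n) k, g.IsHomogeneous d ∧ (f - g * w).IsHomogeneous (d + e) ∧
      f - g * w ∈ Ideal.span s := by
  rw [Ideal.span_insert, sup_comm] at h
  obtain ⟨j, hj, hjd, g, hg⟩ := exists_of_mem_sup_span_singleton (isHomogeneous_span hs) hw hf h
  rw [if_pos (Nat.le_add_left e d), Nat.add_sub_cancel] at hg
  have hg' : f - homogeneousComponent d g * w = j := by rw [hg]; ring
  exact ⟨homogeneousComponent d g, homogeneousComponent_isHomogeneous d g, hg' ▸ hjd, hg' ▸ hj⟩

lemma mem_span_of_mem_span_insert_of_lt {s : Set (MvPolynomial (Fin n) k)}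
    (hs : ∀ t ∈ s, ∃ d : ℕ, t.IsHomogeneous d) {w f : MvPolynomial (Fin n) k} {m e : ℕ}
    (hw : w.IsHomogeneous e) (hf : f.IsHomogeneous m) (hm : m < e)
    (h : f ∈ Ideal.span (insert w s)) : f ∈ Ideal.span s := by
  rw [Ideal.span_insert, sup_comm] at h
  obtain ⟨j, hj, -, g, hg⟩ := exists_of_mem_sup_span_singleton (isHomogeneous_span hs) hw hf h
  rw [if_neg (not_le.2 hm), add_zero] at hg
  exact hg ▸ hj

lemma exists_of_mem_span_pair {x y f : MvPolynomial (Fin n) k} {d e : ℕ}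
    (hx : x.IsHomogeneous e) (hy : y.IsHomogeneous e) (hf : f.IsHomogeneous (d + e))
    (h : f ∈ Ideal.span {x, y}) :
    ∃ a b : MvPolynomial (Fin n) k, a.IsHomogeneous d ∧ b.IsHomogeneous d ∧
      f = a * x + b * y := by
  obtain ⟨a, ha, hfa, h1⟩ := exists_sub_mul_mem_span (by rintro _ rfl; exact ⟨e, hy⟩) hx hf h
  rw [← insert_empty_eq y] at h1
  obtain ⟨b, hb, -, h2⟩ := exists_sub_mul_mem_span (by simp) hy hfa h1
  rw [Ideal.span_empty, Ideal.mem_bot] at h2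
  exact ⟨a, b, ha, hb, by linear_combination h2⟩

lemma exists_eq_C_of_isHomogeneous_zero {f : MvPolynomial (Fin n) k} (hf : f.IsHomogeneous 0) :
    ∃ c : k, f = C c :=
  ⟨_, totalDegree_eq_zero_iff_eq_C.1 ((totalDegree_zero_iff_isHomogeneous _).2 hf)⟩

lemma span_le_ker_constantCoeff {s : Set (MvPolynomial (Fin n) k)}
    (hs : ∀ t ∈ s, ∃ d : ℕ, t.IsHomogeneous (d + 1)) :
    Ideal.span s ≤ RingHom.ker (constantCoeff (σ := Fin n) (R := k)) := by
  refine Ideal.span_le.2 fun t ht => ?_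
  obtain ⟨d, hd⟩ := hs t ht
  exact hd.coeff_eq_zero (by simp)

end LinearForms

/-! ### Heights from Krull's theorem and chains of primes -/

section Height

lemma Ideal.height_span_finset_le_card {R : Type*} [CommRing R] [IsNoetherianRing R]
    (s : Finset R) (h : Ideal.span (s : Set R) ≠ ⊤) : (Ideal.span (s : Set R)).height ≤ s.card := by
  refine (Ideal.height_le_spanRank_toENat _ h).trans ?_
  simpa using Submodule.spanRank_span_le_card (s : Set R)

lemma Ideal.height_add_one_le_height_span_insert {R : Type*} [CommRing R] [IsNoetherianRing R]
    {s : Set R} (hs : (Ideal.span s).IsPrime) {w : R} (hw : w ∉ Ideal.span s) :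
    (Ideal.span s).height + 1 ≤ (Ideal.span (insert w s)).height := by
  refine Order.add_one_le_of_lt (Ideal.height_strict_mono_of_isPrime ?_)
  refine lt_of_le_of_ne (Ideal.span_mono (Set.subset_insert w s)) fun h => hw ?_
  rw [h]
  exact Ideal.subset_span (Set.mem_insert w s)

open MvPolynomial

variable {k : Type*} [Field k] {n : ℕ}

lemma height_span_four {x y a b : MvPolynomial (Fin n) k} (hx : x.IsHomogeneous 1)
    (hy : y.IsHomogeneous 1) (ha : a.IsHomogeneous 1) (hb : b.IsHomogeneous 1)
    (hx0 : x ≠ 0) (hyx : y ∉ Ideal.span {x}) (hav : a ∉ Ideal.span {x, y})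
    (hbv : b ∉ Ideal.span {x, y, a}) : (Ideal.span {x, y, a, b}).height = 4 := by
  classical
  refine le_antisymm ?_ ?_
  · have h := Ideal.height_span_finset_le_card ({x, y, a, b} : Finset (MvPolynomial (Fin n) k))
    push_cast at h
    refine (h (isPrime_span_of_isHomogeneous_one ?_).ne_top).trans
      (by exact_mod_cast Finset.card_le_four)
    rintro _ (rfl | rfl | rfl | rfl) <;> assumption
  · have e2 : ({x, y} : Set (MvPolynomial (Fin n) k)) = {y, x} := Set.pair_comm _ _
    have e3 : ({x, y, a} : Set (MvPolynomial (Fin n) k)) = {a, y, x} := by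
      ext; simp; tauto
    have e4 : ({x, y, a, b} : Set (MvPolynomial (Fin n) k)) = {b, a, y, x} := by
      ext; simp; tauto
    rw [e2] at hav
    rw [e3] at hbv
    rw [e4]
    have h1 := Ideal.height_add_one_le_height_span_insert (s := ∅) (w := x)
      (isPrime_span_of_isHomogeneous_one (by simp)) (by simpa using hx0)
    rw [insert_empty_eq] at h1
    have h2 := Ideal.height_add_one_le_height_span_insert
      (isPrime_span_of_isHomogeneous_one (by simpa using hx)) hyx
    have h3 := Ideal.height_add_one_le_height_span_insert
      (isPrime_span_of_isHomogeneous_one (by simp [hx, hy])) hav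
    have h4 := Ideal.height_add_one_le_height_span_insert
      (isPrime_span_of_isHomogeneous_one (by simp [hx, hy, ha])) hbv
    calc (4 : ℕ∞) = 0 + 1 + 1 + 1 + 1 := by norm_num
      _ ≤ (Ideal.span (∅ : Set (MvPolynomial (Fin n) k))).height + 1 + 1 + 1 + 1 := by
        gcongr; exact zero_le
      _ ≤ _ := by
        refine le_trans ?_ h4; gcongr
        refine le_trans ?_ h3; gcongr
        refine le_trans ?_ h2; gcongr

/-- Only the four-generated ideal must be prime for the height to rise strictly; properness of the
larger one follows from vanishing constant terms. -/
lemma height_span_five {x y a b q : MvPolynomial (Fin n) k} (hx : x.IsHomogeneous 1)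
    (hy : y.IsHomogeneous 1) (ha : a.IsHomogeneous 1) (hb : b.IsHomogeneous 1)
    (hq : q.IsHomogeneous 2) (h4 : (Ideal.span {x, y, a, b}).height = 4)
    (hqv : q ∉ Ideal.span {x, y, a, b}) : (Ideal.span {x, y, a, b, q}).height = 5 := by
  classical
  refine le_antisymm ?_ ?_
  · have h := Ideal.height_span_finset_le_card ({x, y, a, b, q} : Finset (MvPolynomial (Fin n) k))
    push_cast at h
    refine (h fun htop => ?_).trans (by exact_mod_cast Finset.card_le_five)
    have h1 := span_le_ker_constantCoeff (s := {x, y, a, b, q}) (by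
      rintro _ (rfl | rfl | rfl | rfl | rfl)
      exacts [⟨0, hx⟩, ⟨0, hy⟩, ⟨0, ha⟩, ⟨0, hb⟩, ⟨1, hq⟩])
    rw [htop, top_le_iff] at h1
    exact RingHom.ker_ne_top _ h1
  · have e5 : ({x, y, a, b, q} : Set (MvPolynomial (Fin n) k)) = insert q {x, y, a, b} := by
      ext; simp; tauto
    have h5 := Ideal.height_add_one_le_height_span_insert
      (isPrime_span_of_isHomogeneous_one (by simp [hx, hy, ha, hb])) hqv
    rw [h4, ← e5] at h5
    exact le_trans (by norm_num) h5

end Height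

/-! ### Relations ax + by in J -/

section Structure

open MvPolynomial

/-- Modulo (x, y) the pair a, b is a regular sequence, so its only syzygies are the Koszul ones and
(g, h) is proportional to (a, b). -/
lemma exists_sub_mul_mem_of_det_mem {R : Type*} [CommRing R] {x y a b g h : R}
    (hp : (Ideal.span {x, y}).IsPrime) (hpa : (Ideal.span {x, y, a}).IsPrime)
    (ha : a ∉ Ideal.span {x, y}) (hb : b ∉ Ideal.span {x, y, a})
    (hdet : b * g - a * h ∈ Ideal.span {x, y}) :
    ∃ s, g - s * a ∈ Ideal.span {x, y} ∧ h - s * b ∈ Ideal.span {x, y} := by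
  have e3 : ({x, y, a} : Set R) = insert a {x, y} := by ext; simp; tauto
  have h1 : b * g ∈ Ideal.span {x, y, a} := by
    have h2 : a * h ∈ Ideal.span {x, y, a} :=
      Ideal.mul_mem_right _ _ (Ideal.subset_span (by simp))
    have h3 : b * g - a * h ∈ Ideal.span {x, y, a} :=
      Ideal.span_mono (by rw [e3]; exact Set.subset_insert _ _) hdet
    simpa using add_mem h3 h2
  have h4 := (hpa.mem_or_mem h1).resolve_left hb
  rw [e3, Ideal.mem_span_insert] at h4
  obtain ⟨s, z, hz, hg⟩ := h4
  have hgz : g - s * a = z := by rw [hg]; ring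
  refine ⟨s, hgz ▸ hz, (hp.mem_or_mem ?_).resolve_left ha⟩
  have : a * (h - s * b) = b * z - (b * g - a * h) := by rw [hg]; ring
  rw [this]
  exact sub_mem (Ideal.mul_mem_left _ b hz) hdet

lemma mul_mem_of_mem_span_pair {R : Type*} [CommRing R] {x y u : R} {K : Ideal R}
    (hxx : x ^ 2 ∈ K) (hxy : x * y ∈ K) (hyy : y ^ 2 ∈ K) (hu : u ∈ Ideal.span {x, y}) :
    u * x ∈ K ∧ u * y ∈ K := by
  obtain ⟨r, s, rfl⟩ := Ideal.mem_span_pair.1 hu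
  constructor
  · rw [show (r * x + s * y) * x = r * x ^ 2 + s * (x * y) by ring]
    exact add_mem (K.mul_mem_left r hxx) (K.mul_mem_left s hxy)
  · rw [show (r * x + s * y) * y = r * (x * y) + s * y ^ 2 by ring]
    exact add_mem (K.mul_mem_left r hxy) (K.mul_mem_left s hyy)

lemma Ideal.mem_span_triple' {R : Type*} [CommRing R] {x y z f : R} :
    f ∈ Ideal.span {x, y, z} ↔ ∃ a b c, f = a * x + b * y + c * z := by
  rw [Ideal.mem_span_insert]
  constructor
  · rintro ⟨a, u, hu, rfl⟩
    obtain ⟨b, c, rfl⟩ := Ideal.mem_span_pair.1 hu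
    exact ⟨a, b, c, by ring⟩
  · rintro ⟨a, b, c, rfl⟩
    exact ⟨a, b * y + c * z, Ideal.mem_span_pair.2 ⟨b, c, rfl⟩, by ring⟩

variable {k : Type*} [Field k] {n : ℕ}

/-- `L` is generated by all forms of J of degree at least `m`; the remaining homogeneous components
already lie in K. -/
lemma exists_eq_sup_generatedInDegreesGE {J K : Ideal (MvPolynomial (Fin n) k)}
    (hJ : J.IsHomogeneous (homogeneousSubmodule (Fin n) k)) (hK : K ≤ J) (m : ℕ)
    (h : ∀ d < m, ∀ f ∈ J, f.IsHomogeneous d → f ∈ K) :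
    ∃ L : Ideal (MvPolynomial (Fin n) k), GeneratedInDegreesGE L m ∧ J = K ⊔ L := by
  refine ⟨Ideal.span {f | f ∈ J ∧ ∃ d : ℕ, m ≤ d ∧ f.IsHomogeneous d},
    ⟨_, fun f hf => hf.2, rfl⟩, le_antisymm (fun f hf => ?_)
    (sup_le hK (Ideal.span_le.2 fun f hf => hf.1))⟩
  rw [← sum_homogeneousComponent f]
  refine sum_mem fun d _ => ?_
  have hd := homogeneousComponent_isHomogeneous d f
  have hdJ := homogeneousComponent_mem_of_mem hJ hf d
  rcases lt_or_ge d m with hlt | hge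
  · exact Ideal.mem_sup_left (h d hlt _ hdJ hd)
  · exact Ideal.mem_sup_right (Ideal.subset_span ⟨hdJ, d, hge, hd⟩)

/-- A homogeneous primary ideal with radical `(x, y, q)` that contains `q` and `(x, y)²`, and is not
its own radical. -/
structure IsDoubleStructure (x y q : MvPolynomial (Fin n) k)
    (J : Ideal (MvPolynomial (Fin n) k)) : Prop where
  hx : x.IsHomogeneous 1
  hy : y.IsHomogeneous 1
  hq : q.IsHomogeneous 2
  q_notMem : q ∉ Ideal.span {x, y}
  homogeneous : J.IsHomogeneous (homogeneousSubmodule (Fin n) k)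
  primary : J.IsPrimary
  radical_eq : J.radical = Ideal.span {x, y, q}
  q_mem : q ∈ J
  xx_mem : x ^ 2 ∈ J
  xy_mem : x * y ∈ J
  yy_mem : y ^ 2 ∈ J
  not_and : ¬ (x ∈ J ∧ y ∈ J)

namespace IsDoubleStructure

variable {x y q : MvPolynomial (Fin n) k} {J : Ideal (MvPolynomial (Fin n) k)}

lemma isPrime_pair (h : IsDoubleStructure x y q J) : (Ideal.span {x, y}).IsPrime :=
  isPrime_span_of_isHomogeneous_one (by simp [h.hx, h.hy])

lemma isPrime_triple (h : IsDoubleStructure x y q J) {a : MvPolynomial (Fin n) k}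
    (ha : a.IsHomogeneous 1) : (Ideal.span {x, y, a}).IsPrime :=
  isPrime_span_of_isHomogeneous_one (by simp [h.hx, h.hy, ha])

lemma le_span (h : IsDoubleStructure x y q J) : J ≤ Ideal.span {x, y, q} :=
  h.radical_eq ▸ Ideal.le_radical

lemma mem_of_mul_mem (h : IsDoubleStructure x y q J) {u v : MvPolynomial (Fin n) k}
    (huv : u * v ∈ J) (hv : v ∉ Ideal.span {x, y, q}) : u ∈ J :=
  ((Ideal.isPrimary_iff.1 h.primary).2 huv).resolve_right (h.radical_eq ▸ hv)

lemma mem_span_of_mul_mem (h : IsDoubleStructure x y q J) {u v : MvPolynomial (Fin n) k}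
    (huv : u * v ∈ J) (hu : u ∉ J) : v ∈ Ideal.span {x, y, q} :=
  not_imp_comm.1 (h.mem_of_mul_mem huv) hu

lemma mem_pair_of_isHomogeneous_one (h : IsDoubleStructure x y q J) {l : MvPolynomial (Fin n) k}
    (hl : l.IsHomogeneous 1) (hlQ : l ∈ Ideal.span {x, y, q}) : l ∈ Ideal.span {x, y} := by
  have e3 : ({x, y, q} : Set (MvPolynomial (Fin n) k)) = insert q {x, y} := by ext; simp; tauto
  rw [e3] at hlQ
  refine mem_span_of_mem_span_insert_of_lt ?_ h.hq hl one_lt_two hlQ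
  rintro _ (rfl | rfl)
  exacts [⟨1, h.hx⟩, ⟨1, h.hy⟩]

lemma exists_of_isHomogeneous_two (h : IsDoubleStructure x y q J) {f : MvPolynomial (Fin n) k}
    (hf : f.IsHomogeneous 2) (hfQ : f ∈ Ideal.span {x, y, q}) :
    ∃ (a b : MvPolynomial (Fin n) k) (c : k), a.IsHomogeneous 1 ∧ b.IsHomogeneous 1 ∧
      f = a * x + b * y + C c * q := by
  have e3 : ({x, y, q} : Set (MvPolynomial (Fin n) k)) = insert q {x, y} := by ext; simp; tauto
  rw [e3] at hfQ
  obtain ⟨g, hg, hfg, hmem⟩ := exists_sub_mul_mem_span (s := {x, y}) (d := 0) (by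
    rintro _ (rfl | rfl)
    exacts [⟨1, h.hx⟩, ⟨1, h.hy⟩]) h.hq hf hfQ
  obtain ⟨c, rfl⟩ := exists_eq_C_of_isHomogeneous_zero hg
  obtain ⟨a, b, ha, hb, hab⟩ := exists_of_mem_span_pair (d := 1) h.hx h.hy hfg hmem
  exact ⟨a, b, c, ha, hb, by linear_combination hab⟩

lemma det_mem (h : IsDoubleStructure x y q J) {a b c d : MvPolynomial (Fin n) k}
    (hab : a * x + b * y ∈ J) (hcd : c * x + d * y ∈ J) :
    a * d - b * c ∈ Ideal.span {x, y, q} := by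
  by_contra hdet
  refine h.not_and ⟨h.mem_of_mul_mem ?_ hdet, h.mem_of_mul_mem ?_ hdet⟩
  · rw [show x * (a * d - b * c) = d * (a * x + b * y) - b * (c * x + d * y) by ring]
    exact sub_mem (J.mul_mem_left d hab) (J.mul_mem_left b hcd)
  · rw [show y * (a * d - b * c) = a * (c * x + d * y) - c * (a * x + b * y) by ring]
    exact sub_mem (J.mul_mem_left a hcd) (J.mul_mem_left c hab)

/-- If `J` contains a linear form of `(x, y)`, then it is a complete intersection. -/
lemma eq_of_mem (h : IsDoubleStructure x y q J) (hxJ : x ∈ J) :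
    J = Ideal.span {x, y ^ 2, q} := by
  have hle : Ideal.span {x, y ^ 2, q} ≤ J := Ideal.span_le.2 (by
    rintro _ (rfl | rfl | rfl)
    exacts [hxJ, h.yy_mem, h.q_mem])
  refine le_antisymm (fun f hf => ?_) hle
  obtain ⟨a, b, c, rfl⟩ := Ideal.mem_span_triple'.1 (h.le_span hf)
  have hb : b ∈ Ideal.span {x, y, q} := by
    refine h.mem_span_of_mul_mem (u := y) ?_ fun hyJ => h.not_and ⟨hxJ, hyJ⟩
    rw [show y * b = (a * x + b * y + c * q) - a * x - c * q by ring]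
    exact sub_mem (sub_mem hf (J.mul_mem_left a hxJ)) (J.mul_mem_left c h.q_mem)
  obtain ⟨r, s, t, rfl⟩ := Ideal.mem_span_triple'.1 hb
  exact Ideal.mem_span_triple'.2 ⟨a + r * y, s, c + t * y, by ring⟩

section NoLinearForms

variable (h : IsDoubleStructure x y q J)
  (hlin : ∀ α β : k, C α * x + C β * y ∈ J → α = 0 ∧ β = 0)
include h hlin

lemma eq_zero_of_isHomogeneous_one {f : MvPolynomial (Fin n) k} (hf : f.IsHomogeneous 1)
    (hfJ : f ∈ J) : f = 0 := by
  have h1 := h.mem_pair_of_isHomogeneous_one hf (h.le_span hfJ)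
  obtain ⟨a, b, ha, hb, rfl⟩ := exists_of_mem_span_pair (d := 0) h.hx h.hy hf h1
  obtain ⟨α, rfl⟩ := exists_eq_C_of_isHomogeneous_zero ha
  obtain ⟨β, rfl⟩ := exists_eq_C_of_isHomogeneous_zero hb
  obtain ⟨rfl, rfl⟩ := hlin α β hfJ
  simp

lemma eq_zero_of_isHomogeneous_of_lt_two {d : ℕ} (hd : d < 2) {f : MvPolynomial (Fin n) k}
    (hfJ : f ∈ J) (hf : f.IsHomogeneous d) : f = 0 := by
  interval_cases d
  · obtain ⟨c, rfl⟩ := exists_eq_C_of_isHomogeneous_zero hf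
    have h1 := span_le_ker_constantCoeff (s := {x, y, q}) (by
      rintro _ (rfl | rfl | rfl)
      exacts [⟨0, h.hx⟩, ⟨0, h.hy⟩, ⟨1, h.hq⟩]) (h.le_span hfJ)
    rw [RingHom.mem_ker, constantCoeff_C] at h1
    rw [h1, map_zero]
  · exact h.eq_zero_of_isHomogeneous_one hlin hf hfJ

lemma notMem_singleton : y ∉ Ideal.span {x} := fun hyx => by
  have h1 := mem_span_of_isHomogeneous_one (by simpa using h.hx) h.hy hyx
  obtain ⟨c, rfl⟩ := Submodule.mem_span_singleton.1 h1
  exact one_ne_zero (neg_eq_zero.1 (hlin c (-1) (by simp [MvPolynomial.smul_eq_C_mul])).2)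

/-- A relation `c x + d y ∈ J` whose coefficients are dependent modulo `(x, y)` is
trivial modulo `(x, y)`. -/
lemma mem_pair_of_combination_mem {c d : MvPolynomial (Fin n) k} (hc : c.IsHomogeneous 1)
    (hd : d.IsHomogeneous 1) (hcd : c * x + d * y ∈ J) {α β : k} (hαβ : ¬ (α = 0 ∧ β = 0))
    (hu : C α * c + C β * d ∈ Ideal.span {x, y}) :
    c ∈ Ideal.span {x, y} ∧ d ∈ Ideal.span {x, y} := by
  obtain ⟨h1, h2⟩ := mul_mem_of_mem_span_pair h.xx_mem h.xy_mem h.yy_mem hu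
  -- The form -βx + αy is chosen so that its products with `c` and `d` combine the relation with (αc
  -- + βd)x or (αc + βd)y. It is outside J, so primariness puts `c` and `d` in the radical.
  have hv : C (-β) * x + C α * y ∉ J := fun hv => by
    obtain ⟨h3, h4⟩ := hlin _ _ hv
    exact hαβ ⟨h4, neg_eq_zero.1 h3⟩
  constructor
  · refine h.mem_pair_of_isHomogeneous_one hc (h.mem_span_of_mul_mem ?_ hv)
    rw [show (C (-β) * x + C α * y) * c =
      (C α * c + C β * d) * y - C β * (c * x + d * y) by rw [map_neg]; ring]
    exact sub_mem h2 (J.mul_mem_left _ hcd)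
  · refine h.mem_pair_of_isHomogeneous_one hd (h.mem_span_of_mul_mem ?_ hv)
    rw [show (C (-β) * x + C α * y) * d =
      C α * (c * x + d * y) - (C α * c + C β * d) * x by rw [map_neg]; ring]
    exact sub_mem (J.mul_mem_left _ hcd) h1

lemma notMem_pair {c d : MvPolynomial (Fin n) k} (hc : c.IsHomogeneous 1)
    (hd : d.IsHomogeneous 1) (hcd : c * x + d * y ∈ J)
    (hne : ¬ (c ∈ Ideal.span {x, y} ∧ d ∈ Ideal.span {x, y})) : c ∉ Ideal.span {x, y} :=
  fun hcm => hne (h.mem_pair_of_combination_mem hlin hc hd hcd (α := 1) (β := 0) (by simp)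
    (by simpa using hcm))

lemma notMem_triple {c d : MvPolynomial (Fin n) k} (hc : c.IsHomogeneous 1)
    (hd : d.IsHomogeneous 1) (hcd : c * x + d * y ∈ J)
    (hne : ¬ (c ∈ Ideal.span {x, y} ∧ d ∈ Ideal.span {x, y})) : d ∉ Ideal.span {x, y, c} := by
  intro hdm
  have h1 := mem_span_of_isHomogeneous_one (by simp [h.hx, h.hy, hc]) hd hdm
  obtain ⟨α, β, γ, rfl⟩ := Submodule.mem_span_triple.1 h1
  refine hne (h.mem_pair_of_combination_mem hlin hc hd hcd (α := -γ) (β := 1) (by simp) ?_)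
  refine Ideal.mem_span_pair.2 ⟨C α, C β, ?_⟩
  simp only [MvPolynomial.smul_eq_C_mul, map_neg, map_one]
  ring

lemma height_eq_four {c d : MvPolynomial (Fin n) k} (hc : c.IsHomogeneous 1)
    (hd : d.IsHomogeneous 1) (hcd : c * x + d * y ∈ J)
    (hne : ¬ (c ∈ Ideal.span {x, y} ∧ d ∈ Ideal.span {x, y})) :
    (Ideal.span {x, y, c, d}).height = 4 :=
  height_span_four h.hx h.hy hc hd (fun hx0 => one_ne_zero (hlin 1 0 (by simp [hx0])).1) (h.notMem_singleton hlin)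
    (h.notMem_pair hlin hc hd hcd hne) (h.notMem_triple hlin hc hd hcd hne)

lemma eq_of_det {a b c d e f : MvPolynomial (Fin n) k} (ha : a.IsHomogeneous 1)
    (hb : b.IsHomogeneous 1) (hab : a * x + b * y ∈ J) (hcd : c * x + d * y ∈ J)
    (hne : ¬ (a ∈ Ideal.span {x, y} ∧ b ∈ Ideal.span {x, y}))
    (hdet : q = a * d - b * c + e * x + f * y) :
    J = Ideal.span {x ^ 2, x * y, y ^ 2, a * x + b * y, c * x + d * y,
      a * d - b * c + e * x + f * y} := by
  rw [← hdet]
  set K := Ideal.span {x ^ 2, x * y, y ^ 2, a * x + b * y, c * x + d * y, q} with hK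
  refine le_antisymm (fun p hp => ?_) (Ideal.span_le.2 ?_)
  · have hKxx : x ^ 2 ∈ K := Ideal.subset_span (by simp)
    have hKxy : x * y ∈ K := Ideal.subset_span (by simp)
    have hKyy : y ^ 2 ∈ K := Ideal.subset_span (by simp)
    have hKab : a * x + b * y ∈ K := Ideal.subset_span (by simp)
    have hKcd : c * x + d * y ∈ K := Ideal.subset_span (by simp)
    have hKq : q ∈ K := Ideal.subset_span (by simp)
    obtain ⟨g, i, t, rfl⟩ := Ideal.mem_span_triple'.1 (h.le_span hp)
    have hgi : g * x + i * y ∈ J := by simpa using sub_mem hp (J.mul_mem_left t h.q_mem)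
    obtain ⟨r, s, t', hrs⟩ := Ideal.mem_span_triple'.1 (h.det_mem hgi hab)
    -- The determinant bg - ai is t'q modulo (x, y), and q ≡ ad - bc; adding t'(c, d) to (g, i)
    -- cancels it.
    obtain ⟨m, h1, h2⟩ := exists_sub_mul_mem_of_det_mem (g := g + t' * c) (h := i + t' * d)
      h.isPrime_pair (h.isPrime_triple ha) (h.notMem_pair hlin ha hb hab hne)
      (h.notMem_triple hlin ha hb hab hne)
      (Ideal.mem_span_pair.2 ⟨r + t' * e, s + t' * f, by
        linear_combination (-1 : MvPolynomial (Fin n) k) * hrs - t' * hdet⟩)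
    rw [show g * x + i * y + t * q = (g + t' * c - m * a) * x + (i + t' * d - m * b) * y
      + m * (a * x + b * y) - t' * (c * x + d * y) + t * q by ring]
    refine add_mem (sub_mem (add_mem (add_mem ?_ ?_) (K.mul_mem_left m hKab))
      (K.mul_mem_left t' hKcd)) (K.mul_mem_left t hKq)
    · exact (mul_mem_of_mem_span_pair hKxx hKxy hKyy h1).1
    · exact (mul_mem_of_mem_span_pair hKxx hKxy hKyy h2).2
  · rintro _ (rfl | rfl | rfl | rfl | rfl | rfl)
    exacts [h.xx_mem, h.xy_mem, h.yy_mem, hab, hcd, h.q_mem]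

end NoLinearForms

end IsDoubleStructure

end Structure

/-! ### Separating the cases -/

section Classification

lemma Ideal.span_triple_eq_sup {R : Type*} [CommRing R] (x y z : R) :
    Ideal.span {x, y, z} = Ideal.span {x, y} ⊔ Ideal.span {z} := by
  rw [← Ideal.span_union, Set.union_singleton]
  congr 1
  ext; simp; tauto

lemma Ideal.span_triple_congr {R : Type*} [CommRing R] {x y u v : R}
    (h : u - v ∈ Ideal.span {x, y}) : Ideal.span {x, y, u} = Ideal.span {x, y, v} := by
  have key : ∀ u v : R, u - v ∈ Ideal.span {x, y} →
      Ideal.span {x, y, u} ≤ Ideal.span {x, y, v} := fun u v huv => by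
    rw [span_triple_eq_sup, span_triple_eq_sup]
    refine sup_le le_sup_left ((Ideal.span_singleton_le_iff_mem _).2 ?_)
    rw [← sub_add_cancel u v]
    exact Submodule.add_mem_sup huv (Ideal.mem_span_singleton_self v)
  exact le_antisymm (key u v h) (key v u (neg_sub u v ▸ neg_mem h))

open MvPolynomial

namespace IsDoubleStructure

variable {k : Type*} [Field k] {n : ℕ} {x y q : MvPolynomial (Fin n) k}
  {J : Ideal (MvPolynomial (Fin n) k)}

lemma exists_of_linear_form_mem (h : IsDoubleStructure x y q J)
    (hlin : ∃ α β : k, C α * x + C β * y ∈ J ∧ ¬ (α = 0 ∧ β = 0)) :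
    ∃ x' y' : MvPolynomial (Fin n) k, x'.IsHomogeneous 1 ∧ y'.IsHomogeneous 1 ∧
      Ideal.span {x', y'} = Ideal.span {x, y} ∧ J = Ideal.span {x', y' ^ 2, q} := by
  have key : ∀ {x y : MvPolynomial (Fin n) k}, IsDoubleStructure x y q J → ∀ α β : k,
      C α * x + C β * y ∈ J → α ≠ 0 → ∃ x' y' : MvPolynomial (Fin n) k, x'.IsHomogeneous 1 ∧
        y'.IsHomogeneous 1 ∧ Ideal.span {x', y'} = Ideal.span {x, y} ∧
        J = Ideal.span {x', y' ^ 2, q} := by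
    intro x y h α β hJ hα
    -- As α ≠ 0, the form in J can serve as the new `x`, with `y` unchanged.
    set x' := C α * x + C β * y with hx'
    have hinv : C α⁻¹ * C α = (1 : MvPolynomial (Fin n) k) := by
      rw [← C_mul, inv_mul_cancel₀ hα, C_1]
    have hx : x = C α⁻¹ * x' + C (-(α⁻¹ * β)) * y := by
      rw [hx', C_neg, C_mul]
      linear_combination (-x) * hinv
    have hspan : Ideal.span {x', y} = Ideal.span {x, y} := by
      refine le_antisymm (Ideal.span_le.2 ?_) (Ideal.span_le.2 ?_)
      · rintro _ (rfl | rfl)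
        · exact Ideal.mem_span_pair.2 ⟨_, _, rfl⟩
        · exact Ideal.subset_span (by simp)
      · rintro _ (rfl | rfl)
        · exact Ideal.mem_span_pair.2 ⟨_, _, hx.symm⟩
        · exact Ideal.subset_span (by simp)
    have hx'1 : x'.IsHomogeneous 1 := (h.hx.C_mul α).add (h.hy.C_mul β)
    refine ⟨x', y, hx'1, h.hy, hspan, IsDoubleStructure.eq_of_mem (y := y) (q := q)
      { hx := hx'1, hy := h.hy, hq := h.hq, q_notMem := hspan ▸ h.q_notMem,
        homogeneous := h.homogeneous, primary := h.primary,
        radical_eq := by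
          rw [h.radical_eq, Ideal.span_triple_eq_sup, Ideal.span_triple_eq_sup, hspan]
        q_mem := h.q_mem, xx_mem := by rw [pow_two]; exact J.mul_mem_left _ hJ
        xy_mem := J.mul_mem_right _ hJ, yy_mem := h.yy_mem
        not_and := fun hxy => h.not_and ⟨?_, hxy.2⟩ } hJ⟩
    rw [hx]
    exact add_mem (J.mul_mem_left _ hxy.1) (J.mul_mem_left _ hxy.2)
  obtain ⟨α, β, hJ, hne⟩ := hlin
  by_cases hα : α = 0
  · have hβ : β ≠ 0 := fun hβ => hne ⟨hα, hβ⟩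
    have h' : IsDoubleStructure y x q J :=
      { hx := h.hy, hy := h.hx, hq := h.hq, q_notMem := Set.pair_comm x y ▸ h.q_notMem,
        homogeneous := h.homogeneous, primary := h.primary,
        radical_eq := by rw [h.radical_eq, Set.insert_comm]
        q_mem := h.q_mem, xx_mem := h.yy_mem, xy_mem := mul_comm x y ▸ h.xy_mem,
        yy_mem := h.xx_mem, not_and := fun hyx => h.not_and hyx.symm }
    obtain ⟨x', y', h1, h2, h3, h4⟩ := key h' β α (add_comm (C α * x) _ ▸ hJ) hβ
    exact ⟨x', y', h1, h2, h3.trans (by rw [Set.pair_comm]), h4⟩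
  · exact key h α β hJ hα

/-- The case in which `J` contains no linear form, at most one further quadric, and its
coefficients do not give a determinantal expression for `q`. -/
lemma height_eq_five_and_quadrics_mem (h : IsDoubleStructure x y q J)
    (hlin : ∀ α β : k, C α * x + C β * y ∈ J → α = 0 ∧ β = 0)
    {a b : MvPolynomial (Fin n) k} (ha : a.IsHomogeneous 1) (hb : b.IsHomogeneous 1)
    (hab : a * x + b * y ∈ J) (hne : ¬ (a ∈ Ideal.span {x, y} ∧ b ∈ Ideal.span {x, y}))
    (hdet : ∀ c d : MvPolynomial (Fin n) k, c.IsHomogeneous 1 → d.IsHomogeneous 1 →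
      c * x + d * y ∈ J → a * d - b * c - q ∉ Ideal.span {x, y}) :
    (Ideal.span {x, y, a, b, q}).height = 5 ∧
      ∀ f ∈ J, f.IsHomogeneous 2 →
        f ∈ Ideal.span {x ^ 2, x * y, y ^ 2, a * x + b * y, q} := by
  have hav := h.notMem_pair hlin ha hb hab hne
  have hbv := h.notMem_triple hlin ha hb hab hne
  have hpair : ∀ t ∈ ({x, y} : Set (MvPolynomial (Fin n) k)), ∃ d : ℕ, t.IsHomogeneous d := by
    rintro _ (rfl | rfl)
    exacts [⟨1, h.hx⟩, ⟨1, h.hy⟩]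
  refine ⟨height_span_five h.hx h.hy ha hb h.hq (h.height_eq_four hlin ha hb hab hne) ?_, ?_⟩
  · intro hq
    have e4 : ({x, y, a, b} : Set (MvPolynomial (Fin n) k)) = insert b (insert a {x, y}) := by
      ext; simp; tauto
    rw [e4] at hq
    obtain ⟨g, hg, hqg, h1⟩ := exists_sub_mul_mem_span (d := 1) (by
      rintro _ (rfl | ht)
      exacts [⟨1, ha⟩, hpair _ ht]) hb h.hq hq
    obtain ⟨d, hd, -, h2⟩ := exists_sub_mul_mem_span (d := 1) hpair ha hqg h1
    -- Were q in (x, y, a, b), an expression q ≡ da + gb would supply the second relation -gx + dy: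
    -- its product with `b` lies in J, and b lies outside the radical. That contradicts `hdet`.
    have h3 : a * d - b * (-g) - q ∈ Ideal.span {x, y} := by
      rw [show a * d - b * (-g) - q = -(q - g * b - d * a) by ring]
      exact neg_mem h2
    refine hdet (-g) d hg.neg hd (h.mem_of_mul_mem (v := b) ?_ fun hbQ => hbv ?_) h3
    · rw [show (-g * x + d * y) * b = d * (a * x + b * y)
        - (a * d - b * (-g) - q) * x - x * q by ring]
      exact sub_mem (sub_mem (J.mul_mem_left d hab)
        (mul_mem_of_mem_span_pair h.xx_mem h.xy_mem h.yy_mem h3).1) (J.mul_mem_left x h.q_mem)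
    · exact Ideal.span_mono (by rintro _ (rfl | rfl) <;> simp)
        (h.mem_pair_of_isHomogeneous_one hb hbQ)
  · intro f hfJ hf
    obtain ⟨c, d, t, hc, hd, rfl⟩ := h.exists_of_isHomogeneous_two hf (h.le_span hfJ)
    have hcd : c * x + d * y ∈ J := by simpa using sub_mem hfJ (J.mul_mem_left (C t) h.q_mem)
    obtain ⟨e, e', s, -, -, hdets⟩ := h.exists_of_isHomogeneous_two
      ((ha.mul hd).sub (hb.mul hc)) (h.det_mem hab hcd)
    -- Modulo (x, y) the determinant is sq. If s = 0 the new relation is a multiple of the old one;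
    -- otherwise dividing it by s gives the determinant excluded by `hdet`.
    by_cases hs : s = 0
    · obtain ⟨m, h1, h2⟩ := exists_sub_mul_mem_of_det_mem (g := c) (h := d)
        h.isPrime_pair (h.isPrime_triple ha) hav hbv (Ideal.mem_span_pair.2 ⟨-e, -e', by
          rw [hs, map_zero] at hdets
          linear_combination hdets⟩)
      set K := Ideal.span {x ^ 2, x * y, y ^ 2, a * x + b * y, q} with hK
      have hKxx : x ^ 2 ∈ K := Ideal.subset_span (by simp)
      have hKxy : x * y ∈ K := Ideal.subset_span (by simp)
      have hKyy : y ^ 2 ∈ K := Ideal.subset_span (by simp)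
      have hKab : a * x + b * y ∈ K := Ideal.subset_span (by simp)
      have hKq : q ∈ K := Ideal.subset_span (by simp)
      rw [show c * x + d * y + C t * q = (c - m * a) * x + (d - m * b) * y
        + m * (a * x + b * y) + C t * q by ring]
      exact add_mem (add_mem (add_mem (mul_mem_of_mem_span_pair hKxx hKxy hKyy h1).1
        (mul_mem_of_mem_span_pair hKxx hKxy hKyy h2).2) (K.mul_mem_left m hKab))
        (K.mul_mem_left _ hKq)
    · have hinv : C s⁻¹ * C s = (1 : MvPolynomial (Fin n) k) := by
        rw [← C_mul, inv_mul_cancel₀ hs, C_1]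
      refine absurd (Ideal.mem_span_pair.2 ⟨C s⁻¹ * e, C s⁻¹ * e', ?_⟩)
        (hdet (C s⁻¹ * c) (C s⁻¹ * d) (hc.C_mul _) (hd.C_mul _) ?_)
      · linear_combination (-C s⁻¹) * hdets - q * hinv
      · rw [show C s⁻¹ * c * x + C s⁻¹ * d * y = C s⁻¹ * (c * x + d * y) by ring]
        exact J.mul_mem_left _ hcd

end IsDoubleStructure

end Classification

/-! ### Assembly -/

theorem mainTheorem5 {k : Type*} [Field k] [IsAlgClosed k] (n : ℕ)
    (x y q : MvPolynomial (Fin n) k)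
    (hx : x.IsHomogeneous 1) (hy : y.IsHomogeneous 1) (hq : q.IsHomogeneous 2)
    (hprime : (Ideal.span {x, y, q}).IsPrime)
    (hheight : (Ideal.span {x, y, q}).height = 3)
    (hmult : quotientMultiplicity (Ideal.span {x, y, q}) = 2)
    (J : Ideal (MvPolynomial (Fin n) k))
    (hJhom : J.IsHomogeneous (MvPolynomial.homogeneousSubmodule (Fin n) k))
    (hJprimary : J.IsPrimary) (hJrad : J.radical = Ideal.span {x, y, q})
    (hJmult : quotientMultiplicity J = 4)
    (hJquad : ∃ I : Ideal (MvPolynomial (Fin n) k),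
      GeneratedByQuadrics I ∧ I.height = 3 ∧ I ≤ J) :
    ∃ x' y' q' : MvPolynomial (Fin n) k,
      x'.IsHomogeneous 1 ∧ y'.IsHomogeneous 1 ∧ q'.IsHomogeneous 2 ∧
      Ideal.span {x', y'} = Ideal.span {x, y} ∧ q' - q ∈ Ideal.span {x, y} ∧
      (J = Ideal.span {x', y' ^ 2, q'} ∨
       (∃ L : Ideal (MvPolynomial (Fin n) k), GeneratedInDegreesGE L 3 ∧
          J = Ideal.span {x' ^ 2, x' * y', y' ^ 2, q'} ⊔ L) ∨
       (∃ (a b : MvPolynomial (Fin n) k) (L : Ideal (MvPolynomial (Fin n) k)),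
          a.IsHomogeneous 1 ∧ b.IsHomogeneous 1 ∧
          (Ideal.span {x', y', a, b, q'}).height = 5 ∧
          GeneratedInDegreesGE L 3 ∧
          J = Ideal.span {x' ^ 2, x' * y', y' ^ 2, a * x' + b * y', q'} ⊔ L) ∨
       (∃ a b c d e f : MvPolynomial (Fin n) k,
          a.IsHomogeneous 1 ∧ b.IsHomogeneous 1 ∧ c.IsHomogeneous 1 ∧
          d.IsHomogeneous 1 ∧ e.IsHomogeneous 1 ∧ f.IsHomogeneous 1 ∧
          (Ideal.span {x', y', a, b}).height = 4 ∧
          (Ideal.span {x', y', c, d}).height = 4 ∧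
          (Ideal.span {x', y', a * d - b * c}).height = 3 ∧
          q' = a * d - b * c + e * x' + f * y' ∧
          J = Ideal.span {x' ^ 2, x' * y', y' ^ 2, a * x' + b * y', c * x' + d * y',
            a * d - b * c + e * x' + f * y'})) := by
  classical
  have hT : ∀ t ∈ ({x, y, q} : Set (MvPolynomial (Fin n) k)), ∃ d : ℕ, t.IsHomogeneous d := by
    rintro _ (rfl | rfl | rfl)
    exacts [⟨1, hx⟩, ⟨1, hy⟩, ⟨2, hq⟩]
  have hpair : (Ideal.span {x, y}).height ≤ 2 := by
    have h := Ideal.height_span_finset_le_card ({x, y} : Finset (MvPolynomial (Fin n) k))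
    push_cast at h
    refine (h (isPrime_span_of_isHomogeneous_one ?_).ne_top).trans
      (by exact_mod_cast Finset.card_le_two)
    rintro _ (rfl | rfl) <;> assumption
  have hJQ : J ≤ Ideal.span {x, y, q} := hJrad ▸ Ideal.le_radical
  have hne : ¬ Ideal.span {x, y, q} ≤ J := fun hle => by
    rw [le_antisymm hJQ hle, hmult] at hJmult
    norm_num at hJmult
  have hsq : ∀ w : MvPolynomial (Fin n) k, (∃ d : ℕ, w.IsHomogeneous d) →
      w ∈ Ideal.span {x, y, q} ^ 2 → w ∈ J := fun w hw hw2 =>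
    mem_of_mem_radical_sq_of_quotientMultiplicity_lt hT hJhom hJprimary hJrad hne
      (by rw [hJmult]; norm_num) (by rw [hmult]; norm_num) (by rw [hJmult, hmult]; norm_num) hw hw2
  have hxQ : x ∈ Ideal.span {x, y, q} := Ideal.subset_span (by simp)
  have hyQ : y ∈ Ideal.span {x, y, q} := Ideal.subset_span (by simp)
  obtain ⟨q', hq', hq'J, hq'q⟩ : ∃ q' : MvPolynomial (Fin n) k, q'.IsHomogeneous 2 ∧ q' ∈ J ∧
      q' - q ∈ Ideal.span {x, y} := by
    obtain ⟨I, ⟨T, hT2, rfl⟩, hI3, hIJ⟩ := hJquad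
    -- An ideal of height 3 cannot lie in (x, y), whose height is at most 2.
    obtain ⟨t, ht, htxy⟩ : ∃ t ∈ T, t ∉ Ideal.span {x, y} := by
      by_contra! hle
      have h1 := (Ideal.height_mono (Ideal.span_le.2 hle)).trans hpair
      rw [hI3] at h1
      exact absurd h1 (by norm_num)
    have htJ : t ∈ J := hIJ (Ideal.subset_span ht)
    have hins : ({x, y, q} : Set (MvPolynomial (Fin n) k)) = insert q {x, y} := by
      ext; simp; tauto
    obtain ⟨g, hg, -, hmem⟩ := exists_sub_mul_mem_span (s := {x, y}) (d := 0)
      (fun t ht => hT t (by rcases ht with rfl | rfl <;> simp)) hq (hT2 t ht) (hins ▸ hJQ htJ)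
    obtain ⟨c, rfl⟩ := exists_eq_C_of_isHomogeneous_zero hg
    have hc : c ≠ 0 := by
      rintro rfl
      exact htxy (by simpa using hmem)
    have hinv : MvPolynomial.C c⁻¹ * MvPolynomial.C c = (1 : MvPolynomial (Fin n) k) := by
      rw [← MvPolynomial.C_mul, inv_mul_cancel₀ hc, MvPolynomial.C_1]
    refine ⟨MvPolynomial.C c⁻¹ * t, (hT2 t ht).C_mul _, J.mul_mem_left _ htJ, ?_⟩
    rw [show MvPolynomial.C c⁻¹ * t - q = MvPolynomial.C c⁻¹ * (t - MvPolynomial.C c * q) by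
      linear_combination q * hinv]
    exact Ideal.mul_mem_left _ _ hmem
  have hQ' : Ideal.span {x, y, q'} = Ideal.span {x, y, q} :=
    Ideal.span_triple_congr hq'q
  have h : IsDoubleStructure x y q' J :=
    { hx := hx, hy := hy, hq := hq'
      q_notMem := fun hmem => by
        rw [← hQ', Ideal.span_triple_eq_sup, sup_eq_left.2 ((Ideal.span_singleton_le_iff_mem _).2 hmem)] at hheight
        rw [hheight] at hpair
        exact absurd hpair (by norm_num)
      homogeneous := hJhom, primary := hJprimary, radical_eq := hJrad.trans hQ'.symm
      q_mem := hq'J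
      xx_mem := hsq _ ⟨_, hx.pow 2⟩ (Ideal.pow_mem_pow hxQ 2)
      xy_mem := hsq _ ⟨_, hx.mul hy⟩ (pow_two (Ideal.span {x, y, q}) ▸ Ideal.mul_mem_mul hxQ hyQ)
      yy_mem := hsq _ ⟨_, hy.pow 2⟩ (Ideal.pow_mem_pow hyQ 2)
      not_and := fun hxy => hne (by
        rw [← hQ']
        refine Ideal.span_le.2 ?_
        rintro _ (rfl | rfl | rfl)
        exacts [hxy.1, hxy.2, hq'J]) }
  by_cases hlin : ∀ α β : k, MvPolynomial.C α * x + MvPolynomial.C β * y ∈ J → α = 0 ∧ β = 0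
  swap
  · push Not at hlin
    obtain ⟨α, β, hαβ, hne0⟩ := hlin
    obtain ⟨x', y', hx', hy', hspan, hJ⟩ := h.exists_of_linear_form_mem
      ⟨α, β, hαβ, fun h0 => hne0 h0.1 h0.2⟩
    exact ⟨x', y', q', hx', hy', hq', hspan, hq'q, Or.inl hJ⟩
  refine ⟨x, y, q', hx, hy, hq', rfl, hq'q, Or.inr ?_⟩
  have hlow : ∀ {K : Ideal (MvPolynomial (Fin n) k)}, (∀ f ∈ J, f.IsHomogeneous 2 → f ∈ K) →
      ∀ d < 3, ∀ f ∈ J, f.IsHomogeneous d → f ∈ K := by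
    intro K hK d hd f hf hfd
    rcases Nat.lt_or_ge d 2 with hd2 | hd2
    · rw [h.eq_zero_of_isHomogeneous_of_lt_two hlin hd2 hf hfd]
      exact K.zero_mem
    · obtain rfl : d = 2 := by omega
      exact hK f hf hfd
  by_cases hdet : ∃ a b c d : MvPolynomial (Fin n) k, a.IsHomogeneous 1 ∧ b.IsHomogeneous 1 ∧
      c.IsHomogeneous 1 ∧ d.IsHomogeneous 1 ∧ a * x + b * y ∈ J ∧ c * x + d * y ∈ J ∧
      a * d - b * c - q' ∈ Ideal.span {x, y}
  · obtain ⟨a, b, c, d, ha, hb, hc, hd, hab, hcd, hdet⟩ := hdet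
    have hdetv : a * d - b * c ∉ Ideal.span {x, y} := fun hmem =>
      h.q_notMem (by simpa using sub_mem hmem hdet)
    have hneab : ¬ (a ∈ Ideal.span {x, y} ∧ b ∈ Ideal.span {x, y}) := fun hm =>
      hdetv (sub_mem (Ideal.mul_mem_right _ _ hm.1) (Ideal.mul_mem_right _ _ hm.2))
    have hnecd : ¬ (c ∈ Ideal.span {x, y} ∧ d ∈ Ideal.span {x, y}) := fun hm =>
      hdetv (sub_mem (Ideal.mul_mem_left _ _ hm.2) (Ideal.mul_mem_left _ _ hm.1))
    obtain ⟨e, f, he, hf, hef⟩ := exists_of_mem_span_pair (d := 1) hx hy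
      (((ha.mul hd).sub (hb.mul hc)).sub hq').neg (neg_mem hdet)
    have hq'eq : q' = a * d - b * c + e * x + f * y := by linear_combination hef
    refine Or.inr (Or.inr ⟨a, b, c, d, e, f, ha, hb, hc, hd, he, hf,
      h.height_eq_four hlin ha hb hab hneab, h.height_eq_four hlin hc hd hcd hnecd, ?_, hq'eq,
      h.eq_of_det hlin ha hb hab hcd hneab hq'eq⟩)
    -- Since ad - bc ≡ q' modulo (x, y), this ideal is the original prime.
    rw [Ideal.span_triple_congr hdet, hQ', hheight]
  by_cases hquad : ∀ f ∈ J, f.IsHomogeneous 2 → f ∈ Ideal.span {x ^ 2, x * y, y ^ 2, q'}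
  · refine Or.inl (exists_eq_sup_generatedInDegreesGE hJhom (Ideal.span_le.2 ?_) 3 (hlow hquad))
    rintro _ (rfl | rfl | rfl | rfl)
    exacts [h.xx_mem, h.xy_mem, h.yy_mem, h.q_mem]
  push Not at hquad
  obtain ⟨g, hgJ, hg, hgK⟩ := hquad
  obtain ⟨a, b, c, ha, hb, rfl⟩ := h.exists_of_isHomogeneous_two hg (h.le_span hgJ)
  have hab : a * x + b * y ∈ J := by
    simpa using sub_mem hgJ (J.mul_mem_left (MvPolynomial.C c) h.q_mem)
  have hneab : ¬ (a ∈ Ideal.span {x, y} ∧ b ∈ Ideal.span {x, y}) := fun hm => by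
    have hKq : q' ∈ Ideal.span {x ^ 2, x * y, y ^ 2, q'} := Ideal.subset_span (by simp)
    refine hgK (add_mem (add_mem ?_ ?_) (Ideal.mul_mem_left _ _ hKq))
    · exact (mul_mem_of_mem_span_pair (Ideal.subset_span (by simp)) (Ideal.subset_span (by simp))
        (Ideal.subset_span (by simp)) hm.1).1
    · exact (mul_mem_of_mem_span_pair (Ideal.subset_span (by simp)) (Ideal.subset_span (by simp))
        (Ideal.subset_span (by simp)) hm.2).2
  obtain ⟨h5, hquad⟩ := h.height_eq_five_and_quadrics_mem hlin ha hb hab hneab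
    fun c d hc hd hcd hmem => hdet ⟨a, b, c, d, ha, hb, hc, hd, hab, hcd, hmem⟩
  obtain ⟨L, hL, hJL⟩ := exists_eq_sup_generatedInDegreesGE hJhom (Ideal.span_le.2 (by
    rintro _ (rfl | rfl | rfl | rfl | rfl)
    exacts [h.xx_mem, h.xy_mem, h.yy_mem, hab, h.q_mem])) 3 (hlow hquad)
  exact Or.inr (Or.inl ⟨a, b, L, ha, hb, h5, hL, hJL⟩)
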